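/- **Metatheory of the focused sequent calculus for CPL\*.** Let $\prec$ be a converse well-founded accessibility relation on a set of worlds, $\prec^+$ its transitive and $\prec^*$ its reflexive-transitive closure. Polarized propositions over positive atoms $Q^+$ and negative atoms $Q^-$ are $$A^+ ::= Q^+ \mid {\downarrow}A^- \mid \bot \mid \Diamond A^+ \mid \Box A^+, \qquad A^- ::= Q^- \mid {\uparrow}A^+ \mid A^+\supset B^-;$$ the stable ones are $Q^+$, ${\downarrow}A^-$ and $Q^-$, ${\uparrow}A^+$. Contexts $\Gamma$ are finite lists of judgments $A^+[w]$, used only through membership. The sequents are $\Gamma\vdash[A^+[w]]$ (right focus), $\Gamma;\Omega\vdash C^-[w]$ (inversion, $\Omega$ being empty, written $\cdot$, or a single $A^+[w']$ with $w\prec^* w'$) and $\Gamma;[A^-[w']]\vdash C^-[w]$ (left focus, with $w\prec^* w'$). Derivability is defined one world of the succedent at a time (from $\prec^+$-later worlds to earlier ones), inductively by the following rules. * Right focus: $\Gamma\vdash[Q^+[w]]$ if $Q^+[w]\in\Gamma$; $\Gamma\vdash[{\downarrow}A^-[w]]$ from $\Gamma;\cdot\vdash A^-[w]$; $\Gamma\vdash[\Diamond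 A^+[w]]$ from $\Gamma;\cdot\vdash{\uparrow}A^+[w']$ for some $w'$ with $w\prec w'$; $\Gamma\vdash[\Box A^+[w]]$ from $\Gamma;\cdot\vdash{\uparrow}A^+[w']$ for all $w'$ with $w\prec w'$. * Inversion: $\Gamma;\cdot\vdash A^+\supset B^-[w]$ from $\Gamma;A^+[w]\vdash B^-[w]$; $\Gamma;\cdot\vdash{\uparrow}A^+[w]$ from $\Gamma\vdash[A^+[w]]$; $\Gamma;A^+[w']\vdash C^-[w]$ from $\Gamma,A^+[w'];\cdot\vdash C^-[w]$ if $A^+$ is stable; $\Gamma;\cdot\vdash C^-[w]$ from $\Gamma;[A^-[w']]\vdash C^-[w]$ if ${\downarrow}A^-[w']\in\Gamma$, $w\prec^*w'$ and $C^-$ is stable; $\Gamma;\bot[w']\vdash C^-[w]$ always; $\Gamma;\Diamond A^+[w']\vdash C^-[w]$ if for every $w''$ with $w'\prec w''$, derivability of $\Gamma;\cdot\vdash{\uparrow}A^+[w'']$ implies that of $\Gamma;\cdot\vdash C^-[w]$; $\Gamma;\Box A^+[w']\vdash C^-[w]$ if derivability of $\Gamma;\cdot\vdash{\uparrow}A^+[w'']$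 for all $w''$ with $w'\prec w''$ implies that of $\Gamma;\cdot\vdash C^-[w]$. * Left focus: $\Gamma;[Q^-[w]]\vdash Q^-[w]$; $\Gamma;[{\uparrow}A^+[w']]\vdash C^-[w]$ from $\Gamma;A^+[w']\vdash C^-[w]$; $\Gamma;[A^+\supset B^-[w']]\vdash C^-[w]$ from $\Gamma\vdash[A^+[w']]$ and $\Gamma;[B^-[w']]\vdash C^-[w]$. Write $\Gamma\subseteq_w\Gamma'$ if for all $w'$ with $w\prec^*w'$, $A[w']\in\Gamma$ implies $A[w']\in\Gamma'$, and for all $w'$ with $w\prec^+w'$, $A[w']\in\Gamma'$ implies $A[w']\in\Gamma$. Below, stating a sequent means that it is derivable. Then, for all contexts, propositions and worlds: 1. *Generalized weakening.* If $\Gamma\subseteq_w\Gamma'$, then every derivable sequent (of any of the three forms) with context $\Gamma$ and succedent at $w$ stays derivable with $\Gamma'$ in place of $\Gamma$. 2. *Cut.* Let $w'\prec^*w$. If $\Gamma\vdash[A^+[w]]$ and $\Gamma;A^+[w]\vdash C^-[w']$, then $\Gamma;\cdot\vdash C^-[w']$. If $\Gamma;\cdot\vdash A^-[w]$ and $\Gamma;[A^-[w]]\vdash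 C^-[w']$, then $\Gamma;\cdot\vdash C^-[w']$. 3. *Substitution.* Let $w'\prec^*w$. If $\Gamma;\cdot\vdash A^-[w]$ and $\Gamma,{\downarrow}A^-[w];\cdot\vdash C^-[w']$, then $\Gamma;\cdot\vdash C^-[w']$. Likewise, for stable $A^+$, if $\Gamma;\cdot\vdash{\uparrow}A^+[w]$ and $\Gamma,A^+[w];\cdot\vdash C^-[w']$, then $\Gamma;\cdot\vdash C^-[w']$. 4. *Backwards substitution.* For any worlds $w,w'$: if $\Gamma;\cdot\vdash A^-[w]$ and $\Gamma;\cdot\vdash C^-[w']$, then $\Gamma,{\downarrow}A^-[w];\cdot\vdash C^-[w']$. Likewise, for stable $A^+$, if $\Gamma;\cdot\vdash{\uparrow}A^+[w]$ and $\Gamma;\cdot\vdash C^-[w']$, then $\Gamma,A^+[w];\cdot\vdash C^-[w']$. 5. *Identity expansion.* Positive: if $w'\prec^*w$ and, for every context $\Delta$ of judgments at $w$, $\Gamma,\Delta\vdash[A^+[w]]$ implies $\Gamma,\Delta;\cdot\vdash C^-[w']$, then $\Gamma;A^+[w]\vdash C^-[w']$. Negative: if, for every context $\Delta$ of judgments at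 $w$ and every stable $C^-$, $\Gamma,\Delta;[A^-[w]]\vdash C^-[w]$ implies $\Gamma,\Delta;\cdot\vdash C^-[w]$, then $\Gamma;\cdot\vdash A^-[w]$. In particular $\Gamma;A^+[w]\vdash{\uparrow}A^+[w]$ for every $A^+$. 6. *Hypothesis principle.* If ${\downarrow}A^-[w]\in\Gamma$, then $\Gamma;\cdot\vdash A^-[w]$. If $A^+$ is stable and $A^+[w]\in\Gamma$, then $\Gamma;\cdot\vdash{\uparrow}A^+[w]$. -/

import Mathlib

namespace CPLStar

open Relation

universe u v x

mutual
/-- Positive propositions `A⁺ ::= Q⁺ | ↓A⁻ | ⊥ | ◇A⁺ | □A⁺`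
over positive atoms `P` and negative atoms `N`. -/
inductive PosProp (P : Type u) (N : Type v) : Type (max u v)
  | atom (q : P) : PosProp P N
  | down (A : NegProp P N) : PosProp P N
  | bot : PosProp P N
  | dia (A : PosProp P N) : PosProp P N
  | box (A : PosProp P N) : PosProp P N
/-- Negative propositions `A⁻ ::= Q⁻ | ↑A⁺ | A⁺ ⊃ B⁻`. -/
inductive NegProp (P : Type u) (N : Type v) : Type (max u v)
  | atom (q : N) : NegProp P N
  | up (A : PosProp P N) : NegProp P N
  | imp (A : PosProp P N) (B : NegProp P N) : NegProp P N
end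

/-- `A⁺ stable⁺`. -/
inductive PosProp.Stable {P : Type u} {N : Type v} : PosProp P N → Prop
  | atom (q : P) : PosProp.Stable (PosProp.atom q)
  | down (A : NegProp P N) : PosProp.Stable (PosProp.down A)

/-- `A⁻ stable⁻`. -/
inductive NegProp.Stable {P : Type u} {N : Type v} : NegProp P N → Prop
  | atom (q : N) : NegProp.Stable (NegProp.atom q)
  | up (A : PosProp P N) : NegProp.Stable (NegProp.up A)

/-- Contexts: finite lists of judgments `A⁺[w]`.  The rules below only ever look at
membership, and only stable hypotheses are ever added or used. -/
abbrev Ctx (P : Type u) (N : Type v) (W : Type x) : Type (max u v x) :=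
  List (PosProp P N × W)

/-- The world-indexed order `Γ ⊆_w Γ'` on contexts. -/
def CtxLe {P : Type u} {N : Type v} {W : Type x} (acc : W → W → Prop) (w : W)
    (Γ Γ' : Ctx P N W) : Prop :=
  (∀ w', ReflTransGen acc w w' → ∀ A, (A, w') ∈ Γ → (A, w') ∈ Γ') ∧
  (∀ w', TransGen acc w w' → ∀ A, (A, w') ∈ Γ' → (A, w') ∈ Γ)

/-- The three forms of sequent: right focus `Γ ⊢ [A⁺[w]]`, inversion `Γ; Ω ⊢ C⁻[w]`
(where `Ω` is empty or a single judgment `A⁺[w']`), and left focus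
`Γ; [A⁻[w']] ⊢ C⁻[w]`. -/
inductive Sequent (P : Type u) (N : Type v) (W : Type x) : Type (max u v x)
  | rfoc (Γ : Ctx P N W) (A : PosProp P N) (w : W) : Sequent P N W
  | inv (Γ : Ctx P N W) (Ω : Option (PosProp P N × W)) (C : NegProp P N) (w : W) :
      Sequent P N W
  | lfoc (Γ : Ctx P N W) (A : NegProp P N) (w' : W) (C : NegProp P N) (w : W) :
      Sequent P N W

/-- The world of the succedent of a sequent. -/
def Sequent.world {P : Type u} {N : Type v} {W : Type x} : Sequent P N W → W
  | .rfoc _ _ w => w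
  | .inv _ _ _ w => w
  | .lfoc _ _ _ _ w => w

open PosProp NegProp Sequent in
/-- The rules of the focused calculus.  The occurrences of provability to the left of an
arrow in `◇L` and `□L` are read off from `R`, where `R Γ A w` stands for derivability of
`Γ; · ⊢ ↑A[w]`; `R` is instantiated below, by recursion on the accessibility relation.

A sequent with a judgment `A[w']` in the inversion context or under left focus, and
succedent at `w`, is meaningful only if `w ≺* w'`; this is what makes the recursion
possible.  It is recorded here as a premise of the left rules.  Every premise of every rule
inherits it (`↓L` establishes it, and `⊃R` introduces only `w' = w`). -/
inductive Derives {P : Type u} {N : Type v} {W : Type x} (acc : W → W → Prop)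
    (R : Ctx P N W → PosProp P N → W → Prop) : Sequent P N W → Prop
  -- right focus
  | atomR {Γ q w} : (PosProp.atom q, w) ∈ Γ → Derives acc R (rfoc Γ (PosProp.atom q) w)
  | downR {Γ A w} : Derives acc R (inv Γ none A w) → Derives acc R (rfoc Γ (down A) w)
  | diaR {Γ A w w'} : acc w w' → Derives acc R (inv Γ none (up A) w') →
      Derives acc R (rfoc Γ (dia A) w)
  | boxR {Γ A w} : (∀ w', acc w w' → Derives acc R (inv Γ none (up A) w')) →
      Derives acc R (rfoc Γ (box A) w)
  -- inversion
  | impR {Γ A B w} : Derives acc R (inv Γ (some (A, w)) B w) →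
      Derives acc R (inv Γ none (imp A B) w)
  | upR {Γ A w} : Derives acc R (rfoc Γ A w) → Derives acc R (inv Γ none (up A) w)
  | shiftL {Γ A w' C w} : ReflTransGen acc w w' → A.Stable →
      Derives acc R (inv ((A, w') :: Γ) none C w) →
      Derives acc R (inv Γ (some (A, w')) C w)
  | downL {Γ A w' C w} : (down A, w') ∈ Γ → C.Stable → ReflTransGen acc w w' →
      Derives acc R (lfoc Γ A w' C w) → Derives acc R (inv Γ none C w)
  | botL {Γ w' C w} : ReflTransGen acc w w' → Derives acc R (inv Γ (some (bot, w')) C w)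
  | diaL {Γ A w' C w} : ReflTransGen acc w w' →
      (∀ w'', acc w' w'' → R Γ A w'' → Derives acc R (inv Γ none C w)) →
      Derives acc R (inv Γ (some (dia A, w')) C w)
  | boxL {Γ A w' C w} : ReflTransGen acc w w' →
      ((∀ w'', acc w' w'' → R Γ A w'') → Derives acc R (inv Γ none C w)) →
      Derives acc R (inv Γ (some (box A, w')) C w)
  -- left focus
  | atomL {Γ q w} : Derives acc R (lfoc Γ (NegProp.atom q) w (NegProp.atom q) w)
  | upL {Γ A w' C w} : ReflTransGen acc w w' →
      Derives acc R (inv Γ (some (A, w')) C w) → Derives acc R (lfoc Γ (up A) w' C w)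
  | impL {Γ A B w' C w} : ReflTransGen acc w w' → Derives acc R (rfoc Γ A w') →
      Derives acc R (lfoc Γ B w' C w) → Derives acc R (lfoc Γ (imp A B) w' C w)

/-- If `≺` is converse well-founded, so is `≺⁺`. -/
theorem wf_transGen {W : Type x} {acc : W → W → Prop}
    (hwf : WellFounded (fun a b => acc b a)) :
    WellFounded (fun a b => TransGen acc b a) := by
  have h : (fun a b => TransGen acc b a) = TransGen (fun a b => acc b a) := by
    funext a b
    exact propext (transGen_swap (r := acc)).symm
  rw [h]
  exact hwf.transGen

/-- Derivability of `Γ; · ⊢ ↑A[w]`, defined one world at a time: while it is being defined at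
`w`, it is already known at all worlds `w'` with `w ≺⁺ w'`. -/
def Reflected {P : Type u} {N : Type v} {W : Type x} {acc : W → W → Prop}
    (hwf : WellFounded (fun a b => acc b a)) (Γ : Ctx P N W) (A : PosProp P N) (w : W) : Prop :=
  (wf_transGen hwf).fix (C := fun _ => Ctx P N W → PosProp P N → Prop)
    (fun w known Γ A => Derives acc (fun Γ' A' w' => ∃ h : TransGen acc w w', known w' h Γ' A')
      (Sequent.inv Γ none (NegProp.up A) w)) w Γ A

/-- Derivability in the focused sequent calculus. -/
def Provable {P : Type u} {N : Type v} {W : Type x} {acc : W → W → Prop}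
    (hwf : WellFounded (fun a b => acc b a)) (S : Sequent P N W) : Prop :=
  Derives acc (Reflected hwf) S

/-- Only the values of `R` at worlds strictly after that of the succedent matter. -/
theorem Derives.congr {P : Type u} {N : Type v} {W : Type x} {acc : W → W → Prop}
    {R R' : Ctx P N W → PosProp P N → W → Prop} {S : Sequent P N W} (h : Derives acc R S) :
    (∀ w', TransGen acc S.world w' → ∀ Γ A, R Γ A w' ↔ R' Γ A w') → Derives acc R' S := by
  induction h with
  | atomR hm => exact fun _ => .atomR hm
  | downR _ ih => exact fun hR => .downR (ih hR)
  | diaR ha _ ih => exact fun hR => .diaR ha (ih fun w' hw => hR w' (.head ha hw))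
  | boxR _ ih => exact fun hR => .boxR fun w' ha => ih w' ha fun v hv => hR v (.head ha hv)
  | impR _ ih => exact fun hR => .impR (ih hR)
  | upR _ ih => exact fun hR => .upR (ih hR)
  | shiftL hw hs _ ih => exact fun hR => .shiftL hw hs (ih hR)
  | downL hm hs hw _ ih => exact fun hR => .downL hm hs hw (ih hR)
  | botL hw => exact fun _ => .botL hw
  | diaL hw _ ih =>
    exact fun hR => .diaL hw fun v hv hr =>
      ih v hv ((hR v (.tail' hw hv) _ _).2 hr) hR
  | boxL hw _ ih =>
    exact fun hR => .boxL hw fun hr =>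
      ih (fun v hv => (hR v (.tail' hw hv) _ _).2 (hr v hv)) hR
  | atomL => exact fun _ => .atomL
  | upL hw _ ih => exact fun hR => .upL hw (ih hR)
  | impL hw _ _ ih₁ ih₂ =>
    exact fun hR => .impL hw (ih₁ fun v hv => hR v (.trans_right hw hv)) (ih₂ hR)

/-- The reflected provability is provability, so that `Provable` satisfies the rules of the
calculus with itself in the higher-order premises of `◇L` and `□L`. -/
theorem reflected_iff {P : Type u} {N : Type v} {W : Type x} {acc : W → W → Prop}
    (hwf : WellFounded (fun a b => acc b a)) (Γ : Ctx P N W) (A : PosProp P N) (w : W) :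
    Reflected hwf Γ A w ↔ Provable hwf (Sequent.inv Γ none (NegProp.up A) w) := by
  have e : Reflected hwf Γ A w = Derives acc
      (fun Γ' A' w' => ∃ _ : TransGen acc w w', Reflected hwf Γ' A' w')
      (Sequent.inv Γ none (NegProp.up A) w) := by
    rw [Reflected, WellFounded.fix_eq]
    rfl
  rw [e]
  constructor
  · exact fun h => h.congr fun w' hw Γ' A' => ⟨fun ⟨_, h⟩ => h, fun h => ⟨hw, h⟩⟩
  · exact fun h => h.congr fun w' hw Γ' A' => ⟨fun h => ⟨hw, h⟩, fun ⟨_, h⟩ => h⟩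

/-- `Γ ⊢ [A⁺[w]]` is derivable. -/
def RightFocus {P : Type u} {N : Type v} {W : Type x} {acc : W → W → Prop}
    (hwf : WellFounded (fun a b => acc b a)) (Γ : Ctx P N W) (A : PosProp P N) (w : W) : Prop :=
  Provable hwf (Sequent.rfoc Γ A w)

/-- `Γ; Ω ⊢ C⁻[w]` is derivable. -/
def Inversion {P : Type u} {N : Type v} {W : Type x} {acc : W → W → Prop}
    (hwf : WellFounded (fun a b => acc b a)) (Γ : Ctx P N W) (Ω : Option (PosProp P N × W))
    (C : NegProp P N) (w : W) : Prop :=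
  Provable hwf (Sequent.inv Γ Ω C w)

/-- `Γ; [A⁻[w']] ⊢ C⁻[w]` is derivable. -/
def LeftFocus {P : Type u} {N : Type v} {W : Type x} {acc : W → W → Prop}
    (hwf : WellFounded (fun a b => acc b a)) (Γ : Ctx P N W) (A : NegProp P N) (w' : W)
    (C : NegProp P N) (w : W) : Prop :=
  Provable hwf (Sequent.lfoc Γ A w' C w)

end CPLStar

open CPLStar

namespace CPLStar

open Relation

universe u v x

section

variable {P : Type u} {N : Type v} {W : Type x} {acc : W → W → Prop}

/-- The context of a sequent. -/
def Sequent.ctx : Sequent P N W → Ctx P N W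
  | .rfoc Γ _ _ => Γ
  | .inv Γ _ _ _ => Γ
  | .lfoc Γ _ _ _ _ => Γ

/-- Replace the context of a sequent. -/
def Sequent.withCtx (Γ : Ctx P N W) : Sequent P N W → Sequent P N W
  | .rfoc _ A w => .rfoc Γ A w
  | .inv _ Ω C w => .inv Γ Ω C w
  | .lfoc _ A w' C w => .lfoc Γ A w' C w

theorem eq_or_transGen {a b : W} (h : ReflTransGen acc a b) : a = b ∨ TransGen acc a b :=
  (reflTransGen_iff_eq_or_transGen.1 h).imp_left Eq.symm

theorem not_transGen_self (hwf : WellFounded (fun a b => acc b a)) (w : W) :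
    ¬ TransGen acc w w :=
  fun h => (wf_transGen hwf).asymmetric _ _ h h

namespace CtxLe

theorem mono {w v : W} {Γ Γ' : Ctx P N W} (h : CtxLe acc w Γ Γ') (hv : ReflTransGen acc w v) :
    CtxLe acc v Γ Γ' :=
  ⟨fun w' hw => h.1 w' (hv.trans hw), fun w' hw => h.2 w' (hw.trans_right hv)⟩

theorem flip {w v : W} {Γ Γ' : Ctx P N W} (h : CtxLe acc w Γ Γ') (hv : TransGen acc w v) :
    CtxLe acc v Γ' Γ :=
  ⟨fun w' hw => h.2 w' (hv.trans_left hw),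
    fun w' hw => h.1 w' (hv.to_reflTransGen.trans hw.to_reflTransGen)⟩

theorem cons {w : W} {Γ Γ' : Ctx P N W} (h : CtxLe acc w Γ Γ') (J : PosProp P N × W) :
    CtxLe acc w (J :: Γ) (J :: Γ') :=
  ⟨fun w' hw A hA => by
      rcases List.mem_cons.1 hA with rfl | hA
      · exact List.mem_cons_self
      · exact List.mem_cons_of_mem _ (h.1 w' hw A hA),
    fun w' hw A hA => by
      rcases List.mem_cons.1 hA with rfl | hA
      · exact List.mem_cons_self
      · exact List.mem_cons_of_mem _ (h.2 w' hw A hA)⟩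

theorem of_mem_iff {Γ Γ' : Ctx P N W} (h : ∀ J, J ∈ Γ ↔ J ∈ Γ') (w : W) : CtxLe acc w Γ Γ' :=
  ⟨fun _ _ _ => (h _).1, fun _ _ _ => (h _).2⟩

/-- Hypotheses at worlds that are not strictly later may be added. -/
theorem append {Δ : Ctx P N W} {w : W} (h : ∀ J ∈ Δ, ¬ TransGen acc w J.2) (Γ : Ctx P N W) :
    CtxLe acc w Γ (Δ ++ Γ) :=
  ⟨fun _ _ _ => List.mem_append_right _,
    fun _ hw _ hA => (List.mem_append.1 hA).resolve_left fun hd => h _ hd hw⟩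

theorem cons_right {v w : W} (h : ¬ TransGen acc w v) (A : PosProp P N) (Γ : Ctx P N W) :
    CtxLe acc w Γ ((A, v) :: Γ) :=
  append (Δ := [(A, v)]) (by simpa using h) Γ

/-- Hypotheses at worlds that are not visible may be dropped. -/
theorem append_left {Δ : Ctx P N W} {w : W} (h : ∀ J ∈ Δ, ¬ ReflTransGen acc w J.2)
    (Γ : Ctx P N W) : CtxLe acc w (Δ ++ Γ) Γ :=
  ⟨fun _ hw _ hA => (List.mem_append.1 hA).resolve_left fun hd => h _ hd hw,
    fun _ _ _ => List.mem_append_right _⟩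

theorem cons_left {v w : W} (h : ¬ ReflTransGen acc w v) (A : PosProp P N) (Γ : Ctx P N W) :
    CtxLe acc w ((A, v) :: Γ) Γ :=
  append_left (Δ := [(A, v)]) (by simpa using h) Γ

end CtxLe

variable {hwf : WellFounded (fun a b => acc b a)}

/-- Generalized weakening. -/
theorem Provable.weaken {S : Sequent P N W} {Γ' : Ctx P N W} (h : Provable hwf S)
    (hle : CtxLe acc S.world S.ctx Γ') : Provable hwf (S.withCtx Γ') := by
  suffices H : ∀ (w : W) (S : Sequent P N W) (Γ' : Ctx P N W), S.world = w →
      CtxLe acc w S.ctx Γ' → Provable hwf S → Provable hwf (S.withCtx Γ') from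
    H _ S Γ' rfl hle h
  intro w
  induction w using (wf_transGen hwf).induction with
  | _ w later =>
    rintro S Γ' rfl hle h
    induction h generalizing Γ' with
    | atomR hm => exact .atomR (hle.1 _ .refl _ hm)
    | downR _ ih => exact .downR (ih _ later hle)
    | diaR ha hp _ =>
      exact .diaR ha (later _ (.single ha) (.inv _ none _ _) _ rfl (hle.mono (.single ha)) hp)
    | boxR hp _ =>
      exact .boxR fun v ha =>
        later _ (.single ha) (.inv _ none _ _) _ rfl (hle.mono (.single ha)) (hp v ha)
    | impR _ ih => exact .impR (ih _ later hle)
    | upR _ ih => exact .upR (ih _ later hle)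
    | shiftL hw hs _ ih => exact .shiftL hw hs (ih _ later (hle.cons _))
    | downL hm hs hw _ ih => exact .downL (hle.1 _ hw _ hm) hs hw (ih _ later hle)
    | botL hw => exact .botL hw
    | diaL hw _ ih =>
      refine .diaL hw fun v hv hr => ih v hv ((reflected_iff hwf _ _ _).2 ?_) _ later hle
      exact later v (.tail' hw hv) (.inv _ none _ _) _ rfl (hle.flip (.tail' hw hv))
        ((reflected_iff hwf _ _ _).1 hr)
    | boxL hw _ ih =>
      refine .boxL hw fun hr => ih (fun v hv => (reflected_iff hwf _ _ _).2 ?_) _ later hle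
      exact later v (.tail' hw hv) (.inv _ none _ _) _ rfl (hle.flip (.tail' hw hv))
        ((reflected_iff hwf _ _ _).1 (hr v hv))
    | atomL => exact .atomL
    | upL hw _ ih => exact .upL hw (ih _ later hle)
    | impL hw _ _ ih₁ ih₂ =>
      exact .impL hw (ih₁ _ (fun v hv => later v (hv.trans_right hw)) (hle.mono hw))
        (ih₂ _ later hle)

theorem RightFocus.weaken {Γ Γ' : Ctx P N W} {A : PosProp P N} {w : W}
    (h : RightFocus hwf Γ A w) (hle : CtxLe acc w Γ Γ') : RightFocus hwf Γ' A w :=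
  Provable.weaken h hle

theorem Inversion.weaken {Γ Γ' : Ctx P N W} {Ω : Option (PosProp P N × W)} {C : NegProp P N}
    {w : W} (h : Inversion hwf Γ Ω C w) (hle : CtxLe acc w Γ Γ') : Inversion hwf Γ' Ω C w :=
  Provable.weaken h hle

theorem LeftFocus.weaken {Γ Γ' : Ctx P N W} {A : NegProp P N} {w' : W} {C : NegProp P N}
    {w : W} (h : LeftFocus hwf Γ A w' C w) (hle : CtxLe acc w Γ Γ') :
    LeftFocus hwf Γ' A w' C w :=
  Provable.weaken h hle

theorem Inversion.diaL {Γ : Ctx P N W} {A : PosProp P N} {v : W} {C : NegProp P N} {w : W}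
    (hw : ReflTransGen acc w v)
    (h : ∀ v', acc v v' → Inversion hwf Γ none (.up A) v' → Inversion hwf Γ none C w) :
    Inversion hwf Γ (some (.dia A, v)) C w :=
  Derives.diaL hw fun v' hv hr => h v' hv ((reflected_iff hwf _ _ _).1 hr)

theorem Inversion.boxL {Γ : Ctx P N W} {A : PosProp P N} {v : W} {C : NegProp P N} {w : W}
    (hw : ReflTransGen acc w v)
    (h : (∀ v', acc v v' → Inversion hwf Γ none (.up A) v') → Inversion hwf Γ none C w) :
    Inversion hwf Γ (some (.box A, v)) C w :=
  Derives.boxL hw fun hr => h fun v' hv => (reflected_iff hwf _ _ _).1 (hr v' hv)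

mutual

/-- Identity expansion for positive propositions. -/
theorem Inversion.expand_pos (A : PosProp P N) {Γ : Ctx P N W} {w : W} {C : NegProp P N}
    {w' : W} (hw : ReflTransGen acc w' w)
    (h : ∀ Δ : Ctx P N W, (∀ J ∈ Δ, J.2 = w) →
      RightFocus hwf (Δ ++ Γ) A w → Inversion hwf (Δ ++ Γ) none C w') :
    Inversion hwf Γ (some (A, w)) C w' := by
  match A with
  | .atom q =>
    exact Derives.shiftL hw (.atom q)
      (h [(.atom q, w)] (by simp) (Derives.atomR List.mem_cons_self))
  | .down A =>
    refine Derives.shiftL hw (.down A) (h [(.down A, w)] (by simp) (Derives.downR ?_))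
    exact Inversion.expand_neg A fun Δ _ C hC hf =>
      Derives.downL (List.mem_append_right _ List.mem_cons_self) hC .refl hf
  | .bot => exact Derives.botL hw
  | .dia A =>
    exact Inversion.diaL hw fun v hv hr => h [] (by simp) (Derives.diaR hv hr)
  | .box A =>
    exact Inversion.boxL hw fun hr => h [] (by simp) (Derives.boxR hr)
termination_by structural A

/-- Identity expansion for negative propositions. -/
theorem Inversion.expand_neg (A : NegProp P N) {Γ : Ctx P N W} {w : W}
    (h : ∀ Δ : Ctx P N W, (∀ J ∈ Δ, J.2 = w) → ∀ C : NegProp P N, C.Stable →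
      LeftFocus hwf (Δ ++ Γ) A w C w → Inversion hwf (Δ ++ Γ) none C w) :
    Inversion hwf Γ none A w := by
  match A with
  | .atom q => exact h [] (by simp) _ (.atom q) Derives.atomL
  | .up A =>
    refine h [] (by simp) _ (.up A) (Derives.upL .refl ?_)
    exact Inversion.expand_pos A .refl fun Δ _ hf => Derives.upR hf
  | .imp A B =>
    refine Derives.impR (Inversion.expand_pos A .refl fun Δ hΔ hA => ?_)
    refine Inversion.expand_neg B fun Δ' hΔ' C hC hB => ?_
    rw [← List.append_assoc] at hB ⊢
    refine h (Δ' ++ Δ) (fun J hJ => ?_) C hC (Derives.impL .refl ?_ hB)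
    · exact (List.mem_append.1 hJ).elim (hΔ' J) (hΔ J)
    · rw [List.append_assoc]
      refine hA.weaken (.append (fun J hJ => ?_) _)
      rw [hΔ' J hJ]
      exact not_transGen_self hwf w
termination_by structural A

end

theorem Inversion.of_mem_down {Γ : Ctx P N W} {A : NegProp P N} {w : W}
    (h : (PosProp.down A, w) ∈ Γ) : Inversion hwf Γ none A w :=
  Inversion.expand_neg A fun _ _ _ hC hf =>
    Derives.downL (List.mem_append_right _ h) hC .refl hf

theorem Inversion.of_mem_stable {Γ : Ctx P N W} {A : PosProp P N} {w : W} (hA : A.Stable)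
    (h : (A, w) ∈ Γ) : Inversion hwf Γ none (.up A) w := by
  cases hA with
  | atom q => exact Derives.upR (Derives.atomR h)
  | down A => exact Derives.upR (Derives.downR (Inversion.of_mem_down h))

theorem Inversion.imp_inv {Γ : Ctx P N W} {A : PosProp P N} {B : NegProp P N} {w : W}
    (h : Inversion hwf Γ none (.imp A B) w) : Inversion hwf Γ (some (A, w)) B w := by
  cases h with
  | impR h => exact h
  | downL _ hC => cases hC

/-- The judgment that a sequent decomposes on the left is itself derivable, if its world is
strictly later than that of the succedent. -/
def Sequent.Grounded (hwf : WellFounded (fun a b => acc b a)) : Sequent P N W → Prop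
  | .rfoc _ _ _ => True
  | .inv _ none _ _ => True
  | .inv Γ (some (B, v)) _ w => TransGen acc w v → Inversion hwf Γ none (.up B) v
  | .lfoc Γ B v _ w => TransGen acc w v → Inversion hwf Γ none B v

variable (P N) in
/-- Derivable stable hypotheses may be added to grounded sequents with succedent at `u`. -/
def BackAt (hwf : WellFounded (fun a b => acc b a)) (u : W) : Prop :=
  ∀ S : Sequent P N W, S.world = u → S.Grounded hwf → ∀ (A : PosProp P N) (w : W), A.Stable →
    (TransGen acc u w → Inversion hwf S.ctx none (.up A) w) → Provable hwf S →
    Provable hwf (S.withCtx ((A, w) :: S.ctx))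

variable (P N) in
/-- The principles needed at later worlds to establish admissibility of cut at a world. -/
structure Admissible (hwf : WellFounded (fun a b => acc b a)) (u : W) : Prop where
  back : BackAt P N hwf u
  cutPos : ∀ (Γ : Ctx P N W) (A : PosProp P N) (w : W) (C : NegProp P N),
    ReflTransGen acc u w → RightFocus hwf Γ A w → Inversion hwf Γ (some (A, w)) C u →
    Inversion hwf Γ none C u
  cutNeg : ∀ (Γ : Ctx P N W) (A : NegProp P N) (w : W) (C : NegProp P N),
    ReflTransGen acc u w → C.Stable → Inversion hwf Γ none A w → LeftFocus hwf Γ A w C u →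
    Inversion hwf Γ none C u
  subst : ∀ (S : Sequent P N W) (Γ : Ctx P N W) (A : NegProp P N) (w : W), S.world = u →
    S.Grounded hwf → ReflTransGen acc u w → (∀ J, J ∈ S.ctx ↔ J ∈ (PosProp.down A, w) :: Γ) →
    Inversion hwf Γ none A w → Provable hwf S → Provable hwf (S.withCtx Γ)

namespace Admissible

/-- Substitution for a stable hypothesis into a sequent with stable succedent. -/
theorem substStable {u : W} (h : Admissible P N hwf u) {Γ : Ctx P N W} {A : PosProp P N} {w : W}
    {C : NegProp P N} (hA : A.Stable) (hC : C.Stable) (hAw : Inversion hwf Γ none (.up A) w)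
    (hCu : Inversion hwf ((A, w) :: Γ) none C u) : Inversion hwf Γ none C u := by
  by_cases hw : ReflTransGen acc u w
  · exact h.cutNeg Γ _ w C hw hC hAw (Derives.upL hw (Derives.shiftL hw hA hCu))
  · exact hCu.weaken (.cons_left hw A Γ)

theorem subst' {S : Sequent P N W} (h : Admissible P N hwf S.world) {Γ : Ctx P N W}
    {A : NegProp P N} {w : W} (hg : S.Grounded hwf)
    (hΓ : ∀ J, J ∈ S.ctx ↔ J ∈ (PosProp.down A, w) :: Γ)
    (hAw : Inversion hwf Γ none A w) (hS : Provable hwf S) : Provable hwf (S.withCtx Γ) := by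
  by_cases hw : ReflTransGen acc S.world w
  · exact h.subst S Γ A w rfl hg hw hΓ hAw hS
  · refine hS.weaken ⟨fun w' hw' B hB => ?_, fun w' _ B hB => ?_⟩
    · rcases List.mem_cons.1 ((hΓ _).1 hB) with e | hB
      · cases e
        exact absurd hw' hw
      · exact hB
    · exact (hΓ _).2 (List.mem_cons_of_mem _ hB)

end Admissible

/-- Backwards substitution at a world, given admissibility at all later worlds. -/
theorem Provable.addStable {S : Sequent P N W} (h : Provable hwf S)
    (later : ∀ v, TransGen acc S.world v → Admissible P N hwf v) (hg : S.Grounded hwf)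
    {A : PosProp P N} {w : W} (hA : A.Stable) (hw : TransGen acc S.world w)
    (hAw : Inversion hwf S.ctx none (.up A) w) :
    Provable hwf (S.withCtx ((A, w) :: S.ctx)) := by
  induction h with
  | atomR hm => exact .atomR (List.mem_cons_of_mem _ hm)
  | downR _ ih => exact .downR (ih later trivial hw hAw)
  | diaR ha hp _ =>
    exact .diaR ha ((later _ (.single ha)).back (.inv _ none _ _) rfl trivial A w hA
      (fun _ => hAw) hp)
  | boxR hp _ =>
    exact .boxR fun v ha => (later v (.single ha)).back (.inv _ none _ _) rfl trivial A w hA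
      (fun _ => hAw) (hp v ha)
  | impR _ ih => exact .impR (ih later (fun hv => absurd hv (not_transGen_self hwf _)) hw hAw)
  | upR _ ih => exact .upR (ih later trivial hw hAw)
  | @shiftL Γ B v C u huv hB _ ih =>
    have hAw' : Inversion hwf ((B, v) :: Γ) none (.up A) w :=
      (later w hw).back (.inv Γ none (.up A) w) rfl trivial B v hB
        (fun hwv => hg (TransGen.trans hw hwv)) hAw
    refine .shiftL huv hB (Inversion.weaken (hwf := hwf) (ih later trivial hw hAw') ?_)
    exact .of_mem_iff (fun J => (List.Perm.swap _ _ _).mem_iff) _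
  | downL hm hs huv _ ih =>
    exact .downL (List.mem_cons_of_mem _ hm) hs huv
      (ih later (fun _ => Inversion.of_mem_down hm) hw hAw)
  | botL huv => exact .botL huv
  | diaL huv _ ih =>
    refine Inversion.diaL huv fun v' hv hr => ?_
    refine ih v' hv ((reflected_iff hwf _ _ _).2 ?_) later trivial hw hAw
    exact (later v' (.tail' huv hv)).substStable hA (.up _) hAw hr
  | boxL huv _ ih =>
    refine Inversion.boxL huv fun hr => ?_
    refine ih (fun v' hv => (reflected_iff hwf _ _ _).2 ?_) later trivial hw hAw
    exact (later v' (.tail' huv hv)).substStable hA (.up _) hAw (hr v' hv)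
  | atomL => exact .atomL
  | upL huv _ ih => exact .upL huv (ih later hg hw hAw)
  | @impL Γ D B v C u huv hD _ ih₁ ih₂ =>
    refine .impL huv ?_ (ih₂ later (fun hv => ?_) hw hAw)
    · rcases eq_or_transGen huv with rfl | hv
      · exact ih₁ later trivial hw hAw
      · exact (later v hv).back (.rfoc Γ D v) rfl trivial A w hA (fun _ => hAw) hD
    · exact (later v hv).cutPos Γ D v B .refl hD (hg hv).imp_inv

theorem backAt_of_later {u : W} (later : ∀ v, TransGen acc u v → Admissible P N hwf v) :
    BackAt P N hwf u := by
  rintro S rfl hg A w hA hAw h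
  by_cases hw : TransGen acc S.world w
  · exact h.addStable later hg hA hw (hAw hw)
  · exact h.weaken (.cons_right hw A _)

/-- Substitution for `↓A⁻` at a world, given admissibility at all later worlds and cut on
`A⁻`. -/
theorem Provable.substDown {S : Sequent P N W} (h : Provable hwf S) {A : NegProp P N} {w : W}
    {Γ : Ctx P N W} (later : ∀ v, TransGen acc S.world v → Admissible P N hwf v)
    (hback : BackAt P N hwf w)
    (hcut : ∀ (Γ : Ctx P N W) (C : NegProp P N), C.Stable → Inversion hwf Γ none A w →
      LeftFocus hwf Γ A w C S.world → Inversion hwf Γ none C S.world)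
    (hg : S.Grounded hwf) (hw : ReflTransGen acc S.world w)
    (hΓ : ∀ J, J ∈ S.ctx ↔ J ∈ (PosProp.down A, w) :: Γ)
    (hAw : Inversion hwf Γ none A w) : Provable hwf (S.withCtx Γ) := by
  have hdown : ∀ {Γ : Ctx P N W}, Inversion hwf Γ none A w →
      Inversion hwf Γ none (.up (.down A)) w := fun h => Derives.upR (Derives.downR h)
  induction h generalizing Γ with
  | atomR hm =>
    refine .atomR ?_
    rcases List.mem_cons.1 ((hΓ _).1 hm) with e | hm
    · cases e
    · exact hm
  | downR _ ih => exact .downR (ih later hcut trivial hw hΓ hAw)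
  | diaR ha hp _ =>
    exact .diaR ha ((later _ (.single ha)).subst' (S := .inv _ none _ _) trivial hΓ hAw hp)
  | boxR hp _ =>
    exact .boxR fun v ha =>
      (later v (.single ha)).subst' (S := .inv _ none _ _) trivial hΓ hAw (hp v ha)
  | impR _ ih =>
    exact .impR (ih later hcut (fun hv => absurd hv (not_transGen_self hwf _)) hw hΓ hAw)
  | upR _ ih => exact .upR (ih later hcut trivial hw hΓ hAw)
  | @shiftL Γ₁ B v C u huv hB _ ih =>
    refine .shiftL huv hB (ih later hcut trivial hw (fun J => ?_) ?_)
    · have := hΓ J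
      simp only [Sequent.ctx, List.mem_cons] at this ⊢
      tauto
    · refine hback (.inv Γ none A w) rfl trivial B v hB (fun hwv => ?_) hAw
      have hwv' : ¬ ReflTransGen acc v w := fun hvw =>
        not_transGen_self hwf w (hwv.trans_left hvw)
      exact ((hg (hwv.trans_right hw)).weaken (.of_mem_iff hΓ v)).weaken
        (.cons_left hwv' _ _)
  | @downL Γ₁ B v C u hm hs huv _ ih =>
    have hB := ih later hcut (fun _ => Inversion.of_mem_down hm) hw hΓ hAw
    rcases List.mem_cons.1 ((hΓ _).1 hm) with e | hm
    · cases e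
      exact hcut Γ C hs hAw hB
    · exact .downL hm hs huv hB
  | botL huv => exact .botL huv
  | diaL huv _ ih =>
    refine Inversion.diaL huv fun v' hv hr => ?_
    refine ih v' hv ((reflected_iff hwf _ _ _).2 ?_) later hcut trivial hw hΓ hAw
    exact Inversion.weaken ((later v' (.tail' huv hv)).back (.inv Γ none _ v') rfl trivial _ w
      (.down A) (fun _ => hdown hAw) hr) (.of_mem_iff (fun J => (hΓ J).symm) v')
  | boxL huv _ ih =>
    refine Inversion.boxL huv fun hr => ?_
    refine ih (fun v' hv => (reflected_iff hwf _ _ _).2 ?_) later hcut trivial hw hΓ hAw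
    exact Inversion.weaken ((later v' (.tail' huv hv)).back (.inv Γ none _ v') rfl trivial _ w
      (.down A) (fun _ => hdown hAw) (hr v' hv)) (.of_mem_iff (fun J => (hΓ J).symm) v')
  | atomL => exact .atomL
  | upL huv _ ih => exact .upL huv (ih later hcut hg hw hΓ hAw)
  | @impL Γ₁ D B v C u huv hD _ ih₁ ih₂ =>
    refine .impL huv ?_ (ih₂ later hcut (fun hv => ?_) hw hΓ hAw)
    · rcases eq_or_transGen huv with rfl | hv
      · exact ih₁ later hcut trivial hw hΓ hAw
      · exact (later v hv).subst' (S := .rfoc Γ₁ D v) trivial hΓ hAw hD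
    · exact (later v hv).cutPos _ D v B .refl hD (hg hv).imp_inv

/-- The succedent of a sequent, unless it is a right focus. -/
def Sequent.succ? : Sequent P N W → Option (NegProp P N)
  | .rfoc _ _ _ => none
  | .inv _ _ C _ => some C
  | .lfoc _ _ _ C _ => some C

/-- Replace the succedent of a sequent, unless it is a right focus. -/
def Sequent.withSucc (C : NegProp P N) (u : W) : Sequent P N W → Sequent P N W
  | .rfoc Γ A w => .rfoc Γ A w
  | .inv Γ Ω _ _ => .inv Γ Ω C u
  | .lfoc Γ A w' _ _ => .lfoc Γ A w' C u

/-- Left commutation: cut on `↑A⁺` with a stable succedent reduces to cut on `A⁺`. -/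
theorem Provable.cutUp {S : Sequent P N W} (h : Provable hwf S) {A : PosProp P N}
    {C : NegProp P N} {u : W} (hC : C.Stable)
    (later : ∀ v, TransGen acc u v → Admissible P N hwf v)
    (hcut : ∀ Γ : Ctx P N W, RightFocus hwf Γ A S.world →
      Inversion hwf Γ (some (A, S.world)) C u → Inversion hwf Γ none C u)
    (hsucc : S.succ? = some (.up A)) (hg : (S.withSucc C u).Grounded hwf)
    (hw : ReflTransGen acc u S.world) (hup : Inversion hwf S.ctx none (.up A) S.world)
    (hA : Inversion hwf S.ctx (some (A, S.world)) C u) :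
    Provable hwf (S.withSucc C u) := by
  have hback := backAt_of_later later
  induction h with
  | atomR | downR | diaR | boxR => cases hsucc
  | impR | atomL => cases hsucc
  | upR h _ =>
    cases hsucc
    exact hcut _ h hA
  | @shiftL Γ B v D w hwv hB h ih =>
    cases hsucc
    exact .shiftL (hw.trans hwv) hB (ih hcut rfl trivial hw h
      (hback (.inv Γ (some (A, w)) C u) rfl (fun _ => hup) B v hB hg hA))
  | downL hm _ hwv _ ih =>
    exact .downL hm hC (hw.trans hwv)
      (ih hcut hsucc (fun _ => Inversion.of_mem_down hm) hw hup hA)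
  | botL hwv => exact .botL (hw.trans hwv)
  | diaL hwv _ ih =>
    exact .diaL (hw.trans hwv) fun v hv hr => ih v hv hr hcut hsucc trivial hw hup hA
  | boxL hwv _ ih =>
    exact .boxL (hw.trans hwv) fun hr => ih hr hcut hsucc trivial hw hup hA
  | upL hwv _ ih => exact .upL (hw.trans hwv) (ih hcut hsucc hg hw hup hA)
  | @impL Γ D B v E w hwv hD _ _ ih =>
    exact .impL (hw.trans hwv) hD (ih hcut hsucc (fun hv =>
      (later v hv).cutPos Γ D v B .refl hD (hg hv).imp_inv) hw hup hA)

mutual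

theorem cutPos_of_later {u : W} (later : ∀ v, TransGen acc u v → Admissible P N hwf v)
    (A : PosProp P N) {Γ : Ctx P N W} {w : W} {C : NegProp P N} (hw : ReflTransGen acc u w)
    (hA : RightFocus hwf Γ A w) (hC : Inversion hwf Γ (some (A, w)) C u) :
    Inversion hwf Γ none C u := by
  match A with
  | .atom q =>
    cases hA with
    | atomR hm =>
      cases hC with
      | shiftL _ _ h =>
        refine Inversion.weaken (hwf := hwf) h (.of_mem_iff (fun J => ?_) u)
        simp only [List.mem_cons, or_iff_right_iff_imp]
        rintro rfl
        exact hm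
  | .down A =>
    cases hA with
    | downR hA =>
      cases hC with
      | shiftL _ _ h =>
        have hback : BackAt P N hwf w :=
          backAt_of_later fun v hv => later v (hv.trans_right hw)
        exact Provable.substDown (S := .inv _ none C u) h later hback
          (fun Γ C' hC' h₁ h₂ => cutNeg_of_later later A hw hC' h₁ h₂) trivial hw
          (fun _ => Iff.rfl) hA
  | .bot => cases hA
  | .dia A =>
    cases hA with
    | diaR ha h =>
      cases hC with
      | shiftL _ hs => cases hs
      | diaL _ hC => exact hC _ ha ((reflected_iff hwf _ _ _).2 h)
  | .box A =>
    cases hA with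
    | boxR h =>
      cases hC with
      | shiftL _ hs => cases hs
      | boxL _ hC => exact hC fun v ha => (reflected_iff hwf _ _ _).2 (h v ha)
termination_by structural A

theorem cutNeg_of_later {u : W} (later : ∀ v, TransGen acc u v → Admissible P N hwf v)
    (A : NegProp P N) {Γ : Ctx P N W} {w : W} {C : NegProp P N} (hw : ReflTransGen acc u w)
    (hC : C.Stable) (hA : Inversion hwf Γ none A w) (hf : LeftFocus hwf Γ A w C u) :
    Inversion hwf Γ none C u := by
  match A with
  | .atom q =>
    cases hf
    exact hA
  | .up A =>
    cases hf with
    | upL _ h =>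
      exact Provable.cutUp (S := .inv Γ none (.up A) w) hA hC later
        (fun Γ h₁ h₂ => cutPos_of_later later A hw h₁ h₂) rfl trivial hw hA h
  | .imp A B =>
    cases hf with
    | impL _ h₁ h₂ =>
      refine cutNeg_of_later later B hw hC ?_ h₂
      rcases eq_or_transGen hw with rfl | hw'
      · exact cutPos_of_later later A .refl h₁ hA.imp_inv
      · exact (later w hw').cutPos Γ A w B .refl h₁ hA.imp_inv
termination_by structural A

end

theorem admissible (hwf : WellFounded (fun a b => acc b a)) (u : W) : Admissible P N hwf u := by
  induction u using (wf_transGen hwf).induction with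
  | _ u later =>
    refine ⟨backAt_of_later later, fun Γ A w C => cutPos_of_later later A,
      fun Γ A w C => cutNeg_of_later later A, ?_⟩
    rintro S Γ A w rfl hg hw hΓ hA h
    exact h.substDown later (backAt_of_later fun v hv => later v (hv.trans_right hw))
      (fun Γ C hC => cutNeg_of_later later A hw hC) hg hw hΓ hA

theorem Inversion.cut_pos {Γ : Ctx P N W} {A : PosProp P N} {w : W} {C : NegProp P N} {w' : W}
    (hw : ReflTransGen acc w' w) (hA : RightFocus hwf Γ A w)
    (hC : Inversion hwf Γ (some (A, w)) C w') : Inversion hwf Γ none C w' :=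
  (admissible hwf w').cutPos Γ A w C hw hA hC

theorem Inversion.subst_down {Γ : Ctx P N W} {A : NegProp P N} {w : W} {C : NegProp P N}
    {w' : W} (hw : ReflTransGen acc w' w) (hA : Inversion hwf Γ none A w)
    (hC : Inversion hwf ((.down A, w) :: Γ) none C w') : Inversion hwf Γ none C w' :=
  (admissible hwf w').subst (.inv _ none C w') Γ A w rfl trivial hw (fun _ => Iff.rfl) hA hC

theorem Inversion.back_stable {Γ : Ctx P N W} {A : PosProp P N} {w : W} {C : NegProp P N}
    {w' : W} (hA : A.Stable) (hAw : Inversion hwf Γ none (.up A) w)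
    (hC : Inversion hwf Γ none C w') : Inversion hwf ((A, w) :: Γ) none C w' :=
  (admissible hwf w').back (.inv Γ none C w') rfl trivial A w hA (fun _ => hAw) hC

theorem LeftFocus.back_stable {Γ : Ctx P N W} {A : PosProp P N} {w : W} {B C : NegProp P N}
    {w' : W} (hA : A.Stable) (hAw : Inversion hwf Γ none (.up A) w)
    (hC : LeftFocus hwf Γ B w' C w') : LeftFocus hwf ((A, w) :: Γ) B w' C w' :=
  (admissible hwf w').back (.lfoc Γ B w' C w') rfl
    (fun h => absurd h (not_transGen_self hwf w')) A w hA (fun _ => hAw) hC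

/-- Hypotheses at an earlier world may be added. -/
theorem CtxLe.append_earlier (hwf : WellFounded (fun a b => acc b a)) {Δ : Ctx P N W} {w w' : W}
    (hΔ : ∀ J ∈ Δ, J.2 = w') (hw : ReflTransGen acc w' w) (Γ : Ctx P N W) :
    CtxLe acc w Γ (Δ ++ Γ) :=
  .append (fun J hJ h => by
    rw [hΔ J hJ] at h
    exact not_transGen_self hwf w (h.trans_left hw)) Γ

/-- Substitution for a stable hypothesis, with an arbitrary succedent. -/
theorem Inversion.subst_stable {Γ : Ctx P N W} {A : PosProp P N} {w : W} {C : NegProp P N}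
    {w' : W} (hA : A.Stable) (hw : ReflTransGen acc w' w)
    (hAw : Inversion hwf Γ none (.up A) w) (hC : Inversion hwf ((A, w) :: Γ) none C w') :
    Inversion hwf Γ none C w' := by
  refine Inversion.expand_neg C fun Δ hΔ D hD hf => ?_
  have hAw' := hAw.weaken (.append_earlier hwf hΔ hw Γ)
  refine (admissible hwf w').substStable hA hD hAw' ?_
  refine (admissible hwf w').cutNeg _ C w' D .refl hD ?_ (hf.back_stable hA hAw')
  have hle := CtxLe.append_earlier hwf hΔ .refl ((A, w) :: Γ)
  exact (hC.weaken hle).weaken (.of_mem_iff (fun J => List.perm_middle.mem_iff) w')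

/-- Cut on `↑A⁺`, with an arbitrary succedent. -/
theorem Inversion.cut_up {Γ : Ctx P N W} {A : PosProp P N} {w : W} {C : NegProp P N}
    {w' : W} (hw : ReflTransGen acc w' w) (hAw : Inversion hwf Γ none (.up A) w)
    (hC : Inversion hwf Γ (some (A, w)) C w') : Inversion hwf Γ none C w' := by
  have key : (∀ (Δ : Ctx P N W), (∀ J ∈ Δ, J.2 = w') → ∀ D : NegProp P N,
      (Inversion hwf Γ none C w' → Inversion hwf (Δ ++ Γ) none D w') →
      Inversion hwf (Δ ++ Γ) (some (A, w)) D w') → Inversion hwf Γ none C w' := by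
    intro h
    refine Inversion.expand_neg C fun Δ hΔ D hD hf => ?_
    refine (admissible hwf w').cutNeg _ (.up A) w D hw hD
      (hAw.weaken (.append_earlier hwf hΔ hw Γ)) (Derives.upL hw (h Δ hΔ D fun hC => ?_))
    exact (admissible hwf w').cutNeg _ C w' D .refl hD
      (hC.weaken (.append_earlier hwf hΔ .refl Γ)) hf
  have drop : ∀ {Δ : Ctx P N W}, (∀ J ∈ Δ, J.2 = w') → ∀ {v}, acc w v →
      ∀ {B}, Inversion hwf (Δ ++ Γ) none (.up B) v → Inversion hwf Γ none (.up B) v := by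
    intro Δ hΔ v hv B h
    refine h.weaken (.append_left (fun J hJ hJv => ?_) Γ)
    rw [hΔ J hJ] at hJv
    exact not_transGen_self hwf v (.tail' (hJv.trans hw) hv)
  cases hC with
  | shiftL _ hA hC => exact hAw.subst_stable hA hw hC
  | botL => exact key fun _ _ _ _ => Derives.botL hw
  | diaL _ hC =>
    exact key fun Δ hΔ D hD => Inversion.diaL hw fun v hv hr =>
      hD (hC v hv ((reflected_iff hwf _ _ _).2 (drop hΔ hv hr)))
  | boxL _ hC =>
    exact key fun Δ hΔ D hD => Inversion.boxL hw fun hr =>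
      hD (hC fun v hv => (reflected_iff hwf _ _ _).2 (drop hΔ hv (hr v hv)))

theorem Inversion.cut_neg (A : NegProp P N) {Γ : Ctx P N W} {w : W} {C : NegProp P N} {w' : W}
    (hw : ReflTransGen acc w' w) (hA : Inversion hwf Γ none A w)
    (hf : LeftFocus hwf Γ A w C w') : Inversion hwf Γ none C w' := by
  match A with
  | .atom q =>
    cases hf
    exact hA
  | .up A =>
    cases hf with
    | upL _ h => exact Inversion.cut_up hw hA h
  | .imp A B =>
    cases hf with
    | impL _ h₁ h₂ => exact Inversion.cut_neg B hw (.cut_pos .refl h₁ hA.imp_inv) h₂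
termination_by structural A

end

end CPLStar

theorem mainTheorem2 {P : Type*} {N : Type*} {W : Type*} (acc : W → W → Prop)
    (hwf : WellFounded (fun a b => acc b a)) :
    -- Generalized weakening, for each form of sequent.
    ((∀ (Γ Γ' : Ctx P N W) (w : W), CtxLe acc w Γ Γ' →
        (∀ A, RightFocus hwf Γ A w → RightFocus hwf Γ' A w) ∧
        (∀ Ω C, Inversion hwf Γ Ω C w → Inversion hwf Γ' Ω C w) ∧
        (∀ A w' C, LeftFocus hwf Γ A w' C w → LeftFocus hwf Γ' A w' C w)) ∧
    -- Cut admissibility, for positive and for negative cut formulas.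
    (∀ (Γ : Ctx P N W) (A : PosProp P N) (w : W) (C : NegProp P N) (w' : W),
        Relation.ReflTransGen acc w' w →
        RightFocus hwf Γ A w → Inversion hwf Γ (some (A, w)) C w' → Inversion hwf Γ none C w') ∧
    (∀ (Γ : Ctx P N W) (A : NegProp P N) (w : W) (C : NegProp P N) (w' : W),
        Relation.ReflTransGen acc w' w →
        Inversion hwf Γ none A w → LeftFocus hwf Γ A w C w' → Inversion hwf Γ none C w') ∧
    -- Substitution for a hypothesis `↓A⁻`, and for any stable hypothesis.
    (∀ (Γ : Ctx P N W) (A : NegProp P N) (w : W) (C : NegProp P N) (w' : W),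
        Relation.ReflTransGen acc w' w →
        Inversion hwf Γ none A w → Inversion hwf ((PosProp.down A, w) :: Γ) none C w' →
        Inversion hwf Γ none C w') ∧
    (∀ (Γ : Ctx P N W) (A : PosProp P N) (w : W) (C : NegProp P N) (w' : W), A.Stable →
        Relation.ReflTransGen acc w' w →
        Inversion hwf Γ none (NegProp.up A) w → Inversion hwf ((A, w) :: Γ) none C w' →
        Inversion hwf Γ none C w') ∧
    -- Backwards substitution for a hypothesis `↓A⁻`, and for any stable hypothesis.
    (∀ (Γ : Ctx P N W) (A : NegProp P N) (w : W) (C : NegProp P N) (w' : W),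
        Inversion hwf Γ none A w → Inversion hwf Γ none C w' →
        Inversion hwf ((PosProp.down A, w) :: Γ) none C w') ∧
    (∀ (Γ : Ctx P N W) (A : PosProp P N) (w : W) (C : NegProp P N) (w' : W), A.Stable →
        Inversion hwf Γ none (NegProp.up A) w → Inversion hwf Γ none C w' →
        Inversion hwf ((A, w) :: Γ) none C w') ∧
    -- Identity expansion, for positive and for negative propositions.
    (∀ (Γ : Ctx P N W) (A : PosProp P N) (w : W) (C : NegProp P N) (w' : W),
        Relation.ReflTransGen acc w' w →
        (∀ Δ : Ctx P N W, (∀ J ∈ Δ, J.2 = w) →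
          RightFocus hwf (Δ ++ Γ) A w → Inversion hwf (Δ ++ Γ) none C w') →
        Inversion hwf Γ (some (A, w)) C w') ∧
    (∀ (Γ : Ctx P N W) (A : NegProp P N) (w : W),
        (∀ Δ : Ctx P N W, (∀ J ∈ Δ, J.2 = w) → ∀ C : NegProp P N, C.Stable →
          LeftFocus hwf (Δ ++ Γ) A w C w → Inversion hwf (Δ ++ Γ) none C w) →
        Inversion hwf Γ none A w) ∧
    -- Identity and the hypothesis principle.
    (∀ (Γ : Ctx P N W) (A : PosProp P N) (w : W),
        Inversion hwf Γ (some (A, w)) (NegProp.up A) w) ∧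
    (∀ (Γ : Ctx P N W) (A : NegProp P N) (w : W),
        (PosProp.down A, w) ∈ Γ → Inversion hwf Γ none A w) ∧
    (∀ (Γ : Ctx P N W) (A : PosProp P N) (w : W), A.Stable →
        (A, w) ∈ Γ → Inversion hwf Γ none (NegProp.up A) w)) := by
  exact ⟨fun Γ Γ' w hle => ⟨fun _ h => h.weaken hle, fun _ _ h => h.weaken hle,
      fun _ _ _ h => h.weaken hle⟩,
    fun Γ A w C w' hw hA hC => .cut_pos hw hA hC,
    fun Γ A w C w' hw hA hC => .cut_neg A hw hA hC,
    fun Γ A w C w' hw hA hC => .subst_down hw hA hC,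
    fun Γ A w C w' hs hw hA hC => .subst_stable hs hw hA hC,
    fun Γ A w C w' hA hC => .back_stable (.down A) (Derives.upR (Derives.downR hA)) hC,
    fun Γ A w C w' hs hA hC => .back_stable hs hA hC,
    fun Γ A w C w' hw h => .expand_pos A hw h,
    fun Γ A w h => .expand_neg A h,
    fun Γ A w => .expand_pos A .refl fun _ _ h => Derives.upR h,
    fun Γ A w h => .of_mem_down h,
    fun Γ A w hs h => .of_mem_stable hs h⟩
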